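/- Let $E$ be a real normed space of finite dimension $d\ge 1$ with norm $|\cdot|$ (for instance $\mathbb{R}^d$ with an arbitrary norm), let $\lambda_d$ be Lebesgue measure (any Haar measure) on $E$, and let $B(x,t)$ be the ball with centre $x$ and radius $t$. Let $P=f\cdot\lambda_d$ be a probability measure on $E$ with Borel density $f:E\to[0,\infty)$, let $r,s>0$, and assume $\int |x|^{r+\eta}\,dP(x)<\infty$ for some $\eta>0$. Let $(\alpha_n)_{n\ge1}$ be an $L^r(P)$-optimal sequence of quantizers, i.e. for every $n\ge1$, $\alpha_n\subset E$ is nonempty with at most $n$ points and $$\int d(x,\alpha_n)^r\,dP(x)=\inf\Big\{\int d(x,\alpha)^r\,dP(x)\;:\;\emptyset\neq\alpha\subset E,\ \operatorname{card}\alpha\le n\Big\}.$$ For $b>0$ put $$\psi_b(x)=\sup_{n\ge1}\frac{\lambda_d\big(B(x,b\,d(x,\alpha_n))\big)}{P\big(B(x,b\,d(x,\alpha_n))\big)}\in[0,\infty].$$ (Here and below $a/0=\infty$ for $a>0$ and $0/0=0$.) Let $\theta>0$, $\mu\in E$, and let $P_{\theta,\mu}$ be the image of $P$ under $x\mapsto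 (x-\mu)/\theta+\mu$. Assume that $(\theta,\mu)$ is $P$-admissible, i.e. $\{f>0\}\subset \mu(1-\theta)+\theta\{f>0\}$ up to a $\lambda_d$-null set, and that * (H1) for every $M>0$, $\displaystyle\sup_{z\in B(0,M)}\frac{f(\mu+\theta(z-\mu))}{f(z)}\mathbf 1_{\{f(z)>0\}}<\infty$; * (H2) there are $b\in(0,1/2)$ and $M\in(0,\infty)$ with $\displaystyle\int_{B(0,M)^c}\Big(\sup_{0<t\le 2b|x|}\frac{\lambda_d(B(x,t))}{P(B(x,t))}\Big)^{s/(d+r)}dP_{\theta,\mu}(x)<\infty$. Consider further the hypothesis * (H3) $\lambda_d(\cdot\cap\operatorname{supp}P)\ll P$ and $\operatorname{supp}P$ is a finite union of closed convex sets. Then: (a) If $s\in(0,r+d)$, then $\psi_b^{s/(d+r)}\in L^1(P_{\theta,\mu})$ for some $b\in(0,1/2)$. (b) If $s\in(r+d,\infty)$, (H3) holds and $f^{-s/(r+d)}\in L^1_{\mathrm{loc}}(P)$, then $\psi_b^{s/(d+r)}\in L^1(P_{\theta,\mu})$ for some $b\in(0,1/2)$. -/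

import Mathlib

open MeasureTheory Set Module
open scoped ENNReal NNReal

noncomputable section

namespace Quantization

variable {E : Type*} [NormedAddCommGroup E] [NormedSpace ℝ E] [MeasurableSpace E]

/-- The `r`-th power `∫ d(x, α)^r dP(x)` of the `L^r(P)`-quantization error induced by the grid `α`
(only used for nonempty `α`). -/
def distortion (P : Measure E) (r : ℝ) (α : Finset E) : ℝ≥0∞ :=
  ∫⁻ x, ENNReal.ofReal (Metric.infDist x (α : Set E) ^ r) ∂P

/-- `e_{n,r}(P)^r`: the infimum of the distortion over all grids with at least one and at most
`n` points. -/
def optimalDistortion (P : Measure E) (r : ℝ) (n : ℕ) : ℝ≥0∞ :=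
  ⨅ (α : Finset E) (_ : α.Nonempty) (_ : α.card ≤ n), distortion P r α

/-- `(α_n)_{n ≥ 1}` is an `L^r(P)`-optimal sequence of quantizers; the value `α 0` is irrelevant. -/
def IsOptimalSeq (P : Measure E) (r : ℝ) (α : ℕ → Finset E) : Prop :=
  ∀ n, 1 ≤ n → (α n).Nonempty ∧ (α n).card ≤ n ∧ distortion P r (α n) = optimalDistortion P r n

/-- The ratio `lam (B(x,t)) / P (B(x,t))`, with value `∞` if only the denominator vanishes. -/
def ballRatio (lam P : Measure E) (x : E) (t : ℝ) : ℝ≥0∞ :=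
  lam (Metric.closedBall x t) / P (Metric.closedBall x t)

/-- The maximal function `ψ_b` attached to the sequence `(α_n)_{n ≥ 1}`. -/
def maximalFunction (lam P : Measure E) (α : ℕ → Finset E) (b : ℝ) (x : E) : ℝ≥0∞ :=
  ⨆ (n : ℕ) (_ : 1 ≤ n), ballRatio lam P x (b * Metric.infDist x (α n : Set E))

/-- `P_{θ,μ}`: the image of `P` under `x ↦ (x - μ) / θ + μ`. -/
def scaledLaw (P : Measure E) (θ : ℝ) (μ : E) : Measure E :=
  P.map (fun x => θ⁻¹ • (x - μ) + μ)

/-- `(θ, μ)` is admissible for `P = f · lam`: up to a `lam`-null set, `{f > 0}` is contained in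
`μ (1 - θ) + θ {f > 0}`. -/
def Admissible (lam : Measure E) (f : E → ℝ≥0) (θ : ℝ) (μ : E) : Prop :=
  ∀ᵐ x ∂lam, x ∈ {y | 0 < f y} → x ∈ (fun y => (1 - θ) • μ + θ • y) '' {y | 0 < f y}

/-- Hypothesis (H1). -/
def H1 (f : E → ℝ≥0) (θ : ℝ) (μ : E) : Prop :=
  ∀ M : ℝ, 0 < M → BddAbove
    ({z | 0 < f z}.indicator (fun z => f (μ + θ • (z - μ)) / f z) '' Metric.closedBall 0 M)

/-- Hypothesis (H2). -/
def H2 (lam P : Measure E) (r s θ : ℝ) (μ : E) : Prop :=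
  ∃ b ∈ Ioo (0 : ℝ) (1 / 2), ∃ M : ℝ, 0 < M ∧
    ∫⁻ x in (Metric.closedBall 0 M)ᶜ,
      (⨆ t ∈ Ioc (0 : ℝ) (2 * b * ‖x‖), ballRatio lam P x t) ^ (s / (finrank ℝ E + r))
      ∂(scaledLaw P θ μ) < ∞

/-- Hypothesis (H3). -/
def H3 (lam P : Measure E) : Prop :=
  lam.restrict P.support ≪ P ∧
    ∃ 𝒞 : Set (Set E), 𝒞.Finite ∧ (∀ C ∈ 𝒞, IsClosed C ∧ Convex ℝ C) ∧ P.support = ⋃₀ 𝒞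

/-- The integrability assumption on the maximal function:
`ψ_b^{s/(d+r)} ∈ L^1(P_{θ,μ})` for some `b ∈ (0, 1/2)`. -/
def MaximalIntegrability (lam P : Measure E) (r s θ : ℝ) (μ : E) (α : ℕ → Finset E) : Prop :=
  ∃ b ∈ Ioo (0 : ℝ) (1 / 2),
    Integrable (fun x => maximalFunction lam P α b x ^ (s / (finrank ℝ E + r))) (scaledLaw P θ μ)

end Quantization

end

/- Every grid `α n` has a point in a fixed ball, so, for small `b`, the radius `b * d(x, α n)` is at
most `2 * b₀ * ‖x‖` far from the origin, where (H2) applies, and stays bounded near the origin,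
where admissibility and (H1) bound `P_{θ,μ}` by a multiple of `P`. What remains is the local
`P`-integrability of the `p`-th power, `p = s / (d + r)`, of the maximal function
`sup_{0 < t ≤ T} lam (B(x,t)) / P (B(x,t))`. By Besicovitch's covering theorem it is of weak type
`(1, 1)`, which is enough for `p < 1`. For `p > 1`, convexity shows that a ball centred in the
support has `lam`-measure at most `c * lam (B ∩ supp P) ≤ c * ∫_B f⁻¹ dP`; hence the maximal
function is dominated by that of the `P`-density `c * f⁻¹`, and Marcinkiewicz interpolation reduces
the claim to the local integrability of `f ^ (-p)`. -/

noncomputable section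

namespace Quantization

open Metric

section LayerCake

variable {X : Type*} [MeasurableSpace X]

theorem lintegral_Ioi_rpow_eq_top (s : ℝ) :
    ∫⁻ t in Ioi (0 : ℝ), ENNReal.ofReal (t ^ s) = ∞ := by
  by_contra hfin
  refine not_integrableOn_Ioi_rpow s ⟨by fun_prop, ?_⟩
  have hnonneg : 0 ≤ᵐ[volume.restrict (Ioi (0 : ℝ))] fun t => t ^ s :=
    ae_restrict_of_forall_mem measurableSet_Ioi fun t ht => Real.rpow_nonneg (le_of_lt ht) s
  rwa [hasFiniteIntegral_iff_ofReal hnonneg, lt_top_iff_ne_top]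

theorem lintegral_rpow_eq_lintegral_meas_lt (ν : Measure X) {ψ : X → ℝ≥0∞}
    (hψ : Measurable ψ) {p : ℝ} (hp : 0 < p) :
    ∫⁻ x, ψ x ^ p ∂ν = ENNReal.ofReal p *
      ∫⁻ t in Ioi (0 : ℝ), ν {x | ENNReal.ofReal t < ψ x} * ENNReal.ofReal (t ^ (p - 1)) := by
  by_cases hfin : ν {x | ψ x = ∞} = 0
  · have hne : ∀ᵐ x ∂ν, ψ x ≠ ∞ := measure_eq_zero_iff_ae_notMem.1 hfin
    have hlevel : ∀ t ∈ Ioi (0 : ℝ),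
        ν {x | t < (ψ x).toReal} = ν {x | ENNReal.ofReal t < ψ x} := fun t ht =>
      measure_congr <| hne.mono fun x hx =>
        propext (ENNReal.ofReal_lt_iff_lt_toReal (le_of_lt ht) hx).symm
    calc ∫⁻ x, ψ x ^ p ∂ν
        = ∫⁻ x, ENNReal.ofReal ((ψ x).toReal ^ p) ∂ν := by
          refine lintegral_congr_ae (hne.mono fun x hx => ?_)
          dsimp only
          rw [← ENNReal.ofReal_rpow_of_nonneg ENNReal.toReal_nonneg hp.le, ENNReal.ofReal_toReal hx]
      _ = _ := by
          rw [lintegral_rpow_eq_lintegral_meas_lt_mul ν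
            (Filter.Eventually.of_forall fun x => ENNReal.toReal_nonneg)
            hψ.ennreal_toReal.aemeasurable hp]
          congr 1
          exact setLIntegral_congr_fun measurableSet_Ioi fun t ht => by simp only [hlevel t ht]
  · rw [lintegral_eq_top_of_measure_eq_top_ne_zero (hψ.pow_const p).aemeasurable
      (by simpa [hp, hp.not_gt] using hfin), eq_comm, eq_top_iff]
    calc ∞ = ENNReal.ofReal p *
          ∫⁻ t in Ioi (0 : ℝ), ν {x | ψ x = ∞} * ENNReal.ofReal (t ^ (p - 1)) := by
          rw [lintegral_const_mul _ (by fun_prop), lintegral_Ioi_rpow_eq_top, ENNReal.mul_top hfin,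
            ENNReal.mul_top (by simpa using hp)]
      _ ≤ _ := by
          gcongr with t x
          rintro (hx : _ = ∞)
          simp [hx]

theorem lintegral_rpow_le_lintegral_meas_lt (ν : Measure X) (ψ : X → ℝ≥0∞) {p : ℝ}
    (hp : 0 < p) :
    ∫⁻ x, ψ x ^ p ∂ν ≤ ENNReal.ofReal p *
      ∫⁻ t in Ioi (0 : ℝ), ν {x | ENNReal.ofReal t < ψ x} * ENNReal.ofReal (t ^ (p - 1)) := by
  -- A measurable minorant with the same integral replaces the possibly nonmeasurable `ψ ^ p`.
  obtain ⟨g, hg, hgψ, heq⟩ := exists_measurable_le_lintegral_eq ν fun x => ψ x ^ p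
  have hroot : ∀ x, g x ^ p⁻¹ ≤ ψ x := fun x => (ENNReal.rpow_inv_le_iff hp).2 (hgψ x)
  calc ∫⁻ x, ψ x ^ p ∂ν = ∫⁻ x, (g x ^ p⁻¹) ^ p ∂ν := by
        simp only [heq, ENNReal.rpow_inv_rpow hp.ne']
    _ = ENNReal.ofReal p * ∫⁻ t in Ioi (0 : ℝ),
          ν {x | ENNReal.ofReal t < g x ^ p⁻¹} * ENNReal.ofReal (t ^ (p - 1)) :=
        lintegral_rpow_eq_lintegral_meas_lt ν (hg.pow_const _) hp
    _ ≤ _ := by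
        gcongr with t x
        exact hroot x

theorem mul_ofReal_rpow_sub_one_le {t : ℝ} (ht : 0 < t) {a C : ℝ≥0∞}
    (h : ENNReal.ofReal t * a ≤ C) (p : ℝ) :
    a * ENNReal.ofReal (t ^ (p - 1)) ≤ C * ENNReal.ofReal (t ^ (p - 2)) := by
  have hsplit : t ^ (p - 1) = t * t ^ (p - 2) := by
    rw [mul_comm, ← Real.rpow_add_one ht.ne', show p - 2 + 1 = p - 1 by ring]
  calc a * ENNReal.ofReal (t ^ (p - 1))
      = ENNReal.ofReal t * a * ENNReal.ofReal (t ^ (p - 2)) := by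
        rw [hsplit, ENNReal.ofReal_mul ht.le, ← mul_assoc, mul_comm a]
    _ ≤ C * ENNReal.ofReal (t ^ (p - 2)) := by gcongr

theorem lintegral_rpow_lt_top_of_weak_type (ν : Measure X) [IsFiniteMeasure ν] {ψ : X → ℝ≥0∞}
    {p : ℝ} (hp : 0 < p) (hp1 : p < 1) {C : ℝ≥0∞} (hC : C ≠ ∞)
    (hweak : ∀ t : ℝ, 0 < t → ENNReal.ofReal t * ν {x | ENNReal.ofReal t < ψ x} ≤ C) :
    ∫⁻ x, ψ x ^ p ∂ν < ∞ := by
  have hsmall : ∫⁻ t in Ioc (0 : ℝ) 1,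
      ν {x | ENNReal.ofReal t < ψ x} * ENNReal.ofReal (t ^ (p - 1)) < ∞ := by
    have hint : IntegrableOn (fun t : ℝ => t ^ (p - 1)) (Ioc 0 1) :=
      (intervalIntegrable_iff_integrableOn_Ioc_of_le zero_le_one).1
        (intervalIntegral.intervalIntegrable_rpow' (by linarith))
    calc _ ≤ ∫⁻ t in Ioc (0 : ℝ) 1, ν univ * ENNReal.ofReal (t ^ (p - 1)) := by
          gcongr
          exact subset_univ _
      _ < ∞ := by
          rw [lintegral_const_mul _ (by fun_prop)]
          exact ENNReal.mul_lt_top (measure_lt_top _ _) hint.lintegral_lt_top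
  have hlarge : ∫⁻ t in Ioi (1 : ℝ),
      ν {x | ENNReal.ofReal t < ψ x} * ENNReal.ofReal (t ^ (p - 1)) < ∞ := by
    have hint : IntegrableOn (fun t : ℝ => t ^ (p - 2)) (Ioi 1) :=
      integrableOn_Ioi_rpow_of_lt (by linarith) one_pos
    calc _ ≤ ∫⁻ t in Ioi (1 : ℝ), C * ENNReal.ofReal (t ^ (p - 2)) := by
          refine setLIntegral_mono (by fun_prop) fun t (ht : 1 < t) => ?_
          have ht0 : 0 < t := one_pos.trans ht
          exact mul_ofReal_rpow_sub_one_le ht0 (hweak t ht0) p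
      _ < ∞ := by
          rw [lintegral_const_mul _ (by fun_prop)]
          exact ENNReal.mul_lt_top hC.lt_top hint.lintegral_lt_top
  refine (lintegral_rpow_le_lintegral_meas_lt ν ψ hp).trans_lt
    (ENNReal.mul_lt_top ENNReal.ofReal_lt_top ?_)
  rw [← Ioc_union_Ioi_eq_Ioi zero_le_one]
  exact (lintegral_union_le _ _ _).trans_lt (ENNReal.add_lt_top.2 ⟨hsmall, hlarge⟩)

theorem lintegral_rpow_le_of_mul_meas_lt_le (ν P : Measure X) {ψ H : X → ℝ≥0∞}
    (hH : Measurable H) {p : ℝ} (hp : 1 < p) {C : ℝ≥0∞} (hC : C ≠ ∞)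
    (hlevel : ∀ t : ℝ, 0 < t → ENNReal.ofReal t * ν {x | ENNReal.ofReal t < ψ x} ≤
      C * ∫⁻ x in {x | ENNReal.ofReal t < H x}, H x ∂P) :
    ENNReal.ofReal (p - 1) * ∫⁻ x, ψ x ^ p ∂ν ≤ ENNReal.ofReal p * C * ∫⁻ x, H x ^ p ∂P := by
  have hp1 : 0 < p - 1 := sub_pos.2 hp
  have hmeas (t : ℝ) : MeasurableSet {x | ENNReal.ofReal t < H x} :=
    measurableSet_lt measurable_const hH
  have hH_rpow : ∫⁻ x, H x ^ (p - 1) ∂(P.withDensity H) = ∫⁻ x, H x ^ p ∂P := by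
    rw [lintegral_withDensity_eq_lintegral_mul _ hH (hH.pow_const _)]
    refine lintegral_congr fun x => ?_
    calc H x * H x ^ (p - 1) = H x ^ (1 : ℝ) * H x ^ (p - 1) := by rw [ENNReal.rpow_one]
      _ = H x ^ p := by
        rw [← ENNReal.rpow_add_of_nonneg _ _ zero_le_one hp1.le, add_sub_cancel]
  -- Compare the layer cake formulas for `ψ ^ p` under `ν` and for `H ^ (p - 1)` under `H P`.
  calc ENNReal.ofReal (p - 1) * ∫⁻ x, ψ x ^ p ∂ν
      ≤ ENNReal.ofReal (p - 1) * (ENNReal.ofReal p * ∫⁻ t in Ioi (0 : ℝ),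
          ν {x | ENNReal.ofReal t < ψ x} * ENNReal.ofReal (t ^ (p - 1))) := by
        gcongr
        exact lintegral_rpow_le_lintegral_meas_lt ν ψ (by linarith)
    _ ≤ ENNReal.ofReal (p - 1) * (ENNReal.ofReal p * ∫⁻ t in Ioi (0 : ℝ),
          C * (P.withDensity H {x | ENNReal.ofReal t < H x} *
            ENNReal.ofReal (t ^ (p - 1 - 1)))) := by
        gcongr _ * (_ * ?_)
        refine lintegral_mono_ae (ae_restrict_of_forall_mem measurableSet_Ioi fun t ht => ?_)
        rw [withDensity_apply _ (hmeas t), ← mul_assoc, sub_sub, one_add_one_eq_two]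
        exact mul_ofReal_rpow_sub_one_le ht (hlevel t ht) p
    _ = ENNReal.ofReal p * C * ∫⁻ x, H x ^ p ∂P := by
        rw [lintegral_const_mul' _ _ hC, ← hH_rpow,
          lintegral_rpow_eq_lintegral_meas_lt _ hH hp1]
        ring

end LayerCake

theorem exists_measure_le_mul_measure_iUnion_closedBall (X : Type*) [MetricSpace X]
    [SecondCountableTopology X] [HasBesicovitchCovering X] [MeasurableSpace X]
    [OpensMeasurableSpace X] :
    ∃ N : ℕ, ∀ (P ν : Measure X) (A : Set X) (t : X → ℝ) (T : ℝ), (∀ x ∈ A, t x ∈ Ioc 0 T) →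
      (∀ x ∈ A, P (closedBall x (t x)) ≤ ν (closedBall x (t x))) →
      P A ≤ N * ν (⋃ x ∈ A, closedBall x (t x)) := by
  obtain ⟨N, κ, hκ, hN⟩ := HasBesicovitchCovering.no_satelliteConfig (α := X)
  refine ⟨N, fun P ν A t T ht hle => ?_⟩
  let q : Besicovitch.BallPackage A X :=
    { c := fun x => x
      r := fun x => t x
      rpos := fun x => (ht x x.2).1
      r_bound := T
      r_le := fun x => (ht x x.2).2 }
  obtain ⟨u, hdisj, hcov⟩ := Besicovitch.exist_disjoint_covering_families hκ hN q
  have hcount (i : Fin N) : (u i).Countable :=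
    (hdisj i).countable_of_nonempty_interior fun j _ =>
      ⟨j, ball_subset_interior_closedBall (mem_ball_self (q.rpos j))⟩
  have hfamily (i : Fin N) :
      P (⋃ j ∈ u i, closedBall (q.c j) (q.r j)) ≤ ν (⋃ x ∈ A, closedBall x (t x)) :=
    calc P (⋃ j ∈ u i, closedBall (q.c j) (q.r j))
        = ∑' j : u i, P (closedBall (q.c j) (q.r j)) :=
          measure_biUnion (hcount i) (hdisj i) fun _ _ => measurableSet_closedBall
      _ ≤ ∑' j : u i, ν (closedBall (q.c j) (q.r j)) :=
          ENNReal.tsum_le_tsum fun j => hle _ j.1.2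
      _ = ν (⋃ j ∈ u i, closedBall (q.c j) (q.r j)) :=
          (measure_biUnion (hcount i) (hdisj i) fun _ _ => measurableSet_closedBall).symm
      _ ≤ ν (⋃ x ∈ A, closedBall x (t x)) :=
          measure_mono <| iUnion₂_subset fun j _ =>
            subset_biUnion_of_mem (u := fun x => closedBall x (t x)) j.2
  have hA : A ⊆ ⋃ i, ⋃ j ∈ u i, closedBall (q.c j) (q.r j) := fun x hx =>
    iUnion_mono (fun i => iUnion₂_mono fun j _ => ball_subset_closedBall) (hcov ⟨⟨x, hx⟩, rfl⟩)
  calc P A ≤ ∑ i, P (⋃ j ∈ u i, closedBall (q.c j) (q.r j)) :=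
        (measure_mono hA).trans (measure_iUnion_fintype_le _ _)
    _ ≤ ∑ _i : Fin N, ν (⋃ x ∈ A, closedBall x (t x)) := Finset.sum_le_sum fun i _ => hfamily i
    _ = N * ν (⋃ x ∈ A, closedBall x (t x)) := by simp

section TruncatedMaximal

variable {E : Type*} [NormedAddCommGroup E] [MeasurableSpace E]

/-- The centred maximal function `sup_{0 < t ≤ T} lam (B(x,t)) / P (B(x,t))` of `lam` with respect
to `P` over radii at most `T`, which is the integrand of (H2) for `T = 2 b ‖x‖`. It need not be
measurable, so the integrals of its powers below are lower integrals. -/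
def truncatedMaximal (lam P : Measure E) (T : ℝ) (x : E) : ℝ≥0∞ :=
  ⨆ t ∈ Ioc 0 T, ballRatio lam P x t

theorem ballRatio_le_truncatedMaximal (lam P : Measure E) (x : E) {t T : ℝ} (ht : t ∈ Ioc 0 T) :
    ballRatio lam P x t ≤ truncatedMaximal lam P T x :=
  le_iSup₂ (f := fun t (_ : t ∈ Ioc 0 T) => ballRatio lam P x t) t ht

theorem truncatedMaximal_mono {lam lam' P : Measure E} {T : ℝ} {x : E}
    (h : ∀ t ∈ Ioc 0 T, lam (closedBall x t) ≤ lam' (closedBall x t)) :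
    truncatedMaximal lam P T x ≤ truncatedMaximal lam' P T x :=
  iSup₂_mono fun t ht => ENNReal.div_le_div_right (h t ht) _

theorem truncatedMaximal_le_add_of_le_add_smul {lam lam' P : Measure E} {σ : ℝ≥0∞}
    (h : lam ≤ lam' + σ • P) (T : ℝ) (x : E) :
    truncatedMaximal lam P T x ≤ truncatedMaximal lam' P T x + σ := by
  refine iSup₂_le fun t ht => ?_
  calc ballRatio lam P x t
      ≤ (lam' (closedBall x t) + σ * P (closedBall x t)) / P (closedBall x t) :=
        ENNReal.div_le_div_right (h _) _
    _ = ballRatio lam' P x t + σ * P (closedBall x t) / P (closedBall x t) := ENNReal.add_div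
    _ ≤ truncatedMaximal lam' P T x + σ :=
        add_le_add (ballRatio_le_truncatedMaximal lam' P x ht) (ENNReal.div_le_of_le_mul le_rfl)

theorem withDensity_le_withDensity_restrict_add_smul {X : Type*} [MeasurableSpace X]
    (P : Measure X) {h : X → ℝ≥0∞} (hh : Measurable h) (σ : ℝ≥0∞) :
    P.withDensity h ≤ (P.restrict {x | σ < h x}).withDensity h + σ • P := by
  have hS : MeasurableSet {x | σ < h x} := measurableSet_lt measurable_const hh
  rw [← withDensity_indicator hS, ← withDensity_const, ← withDensity_add_left (hh.indicator hS)]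
  refine withDensity_mono (Filter.Eventually.of_forall fun x => ?_)
  by_cases hx : σ < h x
  · exact (indicator_of_mem (show x ∈ {x | σ < h x} from hx) h).symm.le.trans le_self_add
  · exact (not_lt.1 hx).trans le_add_self

variable [ProperSpace E] [BorelSpace E] [HasBesicovitchCovering E]

variable (E) in
theorem exists_mul_measure_lt_truncatedMaximal_le :
    ∃ N : ℕ, ∀ (lam P : Measure E) (x₀ : E) (ρ T : ℝ) (τ : ℝ≥0∞),
      τ * P ({x | τ < truncatedMaximal lam P T x} ∩ closedBall x₀ ρ) ≤
        N * lam (closedBall x₀ (ρ + T)) := by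
  obtain ⟨N, hN⟩ := exists_measure_le_mul_measure_iUnion_closedBall E
  refine ⟨N, fun lam P x₀ ρ T τ => ?_⟩
  set A := {x | τ < truncatedMaximal lam P T x} ∩ closedBall x₀ ρ
  have hradius : ∀ x ∈ A, ∃ t ∈ Ioc 0 T, (τ • P) (closedBall x t) ≤ lam (closedBall x t) := by
    rintro x ⟨hx : τ < ⨆ t ∈ Ioc 0 T, ballRatio lam P x t, -⟩
    simp only [lt_iSup_iff] at hx
    obtain ⟨t, ht, hlt⟩ := hx
    exact ⟨t, ht, ENNReal.mul_le_of_le_div hlt.le⟩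
  choose! t ht hle using hradius
  refine (hN (τ • P) lam A t T ht hle).trans ?_
  gcongr
  refine iUnion₂_subset fun x hx => closedBall_subset_closedBall' ?_
  linarith [(ht x hx).2, mem_closedBall.1 hx.2]

theorem setLIntegral_truncatedMaximal_rpow_lt_top_of_lt_one (lam P : Measure E)
    [IsLocallyFiniteMeasure lam] [IsLocallyFiniteMeasure P] {p : ℝ} (hp : 0 < p) (hp1 : p < 1)
    (x₀ : E) (ρ T : ℝ) :
    ∫⁻ x in closedBall x₀ ρ, truncatedMaximal lam P T x ^ p ∂P < ∞ := by
  obtain ⟨N, hN⟩ := exists_mul_measure_lt_truncatedMaximal_le E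
  have : IsFiniteMeasure (P.restrict (closedBall x₀ ρ)) :=
    isFiniteMeasure_restrict.2 measure_closedBall_lt_top.ne
  refine lintegral_rpow_lt_top_of_weak_type _ hp hp1
    (C := N * lam (closedBall x₀ (ρ + T)))
    (ENNReal.mul_ne_top (ENNReal.natCast_ne_top N) measure_closedBall_lt_top.ne) fun t _ => ?_
  rw [Measure.restrict_apply' measurableSet_closedBall]
  exact hN lam P x₀ ρ T _

variable (E) in
theorem exists_mul_measure_lt_truncatedMaximal_withDensity_le :
    ∃ N : ℕ, ∀ (P : Measure E) (h : E → ℝ≥0∞), Measurable h → ∀ (x₀ : E) (ρ T : ℝ) (τ : ℝ≥0∞),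
      τ * P ({x | τ < truncatedMaximal (P.withDensity h) P T x} ∩ closedBall x₀ ρ) ≤
        N * ∫⁻ x in {x | τ < 2 * h x}, 2 * h x ∂(P.restrict (closedBall x₀ (ρ + T))) := by
  obtain ⟨N, hN⟩ := exists_mul_measure_lt_truncatedMaximal_le E
  refine ⟨N, fun P h hh x₀ ρ T τ => ?_⟩
  -- Only the part of `h` above `τ / 2` matters: the rest contributes at most `τ / 2` to each ratio.
  set lam := (P.restrict {x | τ / 2 < h x}).withDensity h with hlam
  have hsub : {x | τ < truncatedMaximal (P.withDensity h) P T x} ⊆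
      {x | τ / 2 < truncatedMaximal lam P T x} := fun x (hx : τ < _) => by
    refine lt_of_add_lt_add_right (a := τ / 2) ?_
    rw [ENNReal.add_halves]
    exact hx.trans_le (truncatedMaximal_le_add_of_le_add_smul
      (withDensity_le_withDensity_restrict_add_smul P hh _) T x)
  have hS : {x | τ / 2 < h x} = {x | τ < 2 * h x} := by
    ext x
    exact ENNReal.div_lt_iff (.inl two_ne_zero) (.inl ENNReal.ofNat_ne_top) |>.trans
      (by rw [mul_comm]; rfl)
  calc τ * P ({x | τ < truncatedMaximal (P.withDensity h) P T x} ∩ closedBall x₀ ρ)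
      ≤ 2 * (τ / 2 * P ({x | τ / 2 < truncatedMaximal lam P T x} ∩ closedBall x₀ ρ)) := by
        rw [← mul_assoc, ENNReal.mul_div_cancel two_ne_zero ENNReal.ofNat_ne_top]
        gcongr
    _ ≤ 2 * (N * lam (closedBall x₀ (ρ + T))) := by gcongr 2 * ?_; exact hN lam P x₀ ρ T _
    _ = N * ∫⁻ x in {x | τ < 2 * h x}, 2 * h x ∂(P.restrict (closedBall x₀ (ρ + T))) := by
        rw [hlam, withDensity_apply _ measurableSet_closedBall, lintegral_const_mul _ hh, hS,
          Measure.restrict_restrict measurableSet_closedBall,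
          Measure.restrict_restrict (measurableSet_lt measurable_const (hh.const_mul 2)),
          inter_comm]
        ring

theorem setLIntegral_truncatedMaximal_withDensity_rpow_lt_top (P : Measure E) {h : E → ℝ≥0∞}
    (hh : Measurable h) {p : ℝ} (hp : 1 < p) {x₀ : E} {ρ T : ℝ}
    (hint : ∫⁻ x in closedBall x₀ (ρ + T), h x ^ p ∂P < ∞) :
    ∫⁻ x in closedBall x₀ ρ, truncatedMaximal (P.withDensity h) P T x ^ p ∂P < ∞ := by
  obtain ⟨N, hN⟩ := exists_mul_measure_lt_truncatedMaximal_withDensity_le E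
  have hp0 : 0 ≤ p := by linarith
  have hint' : ∫⁻ x in closedBall x₀ (ρ + T), (2 * h x) ^ p ∂P < ∞ := by
    simp_rw [ENNReal.mul_rpow_of_nonneg _ _ hp0]
    rw [lintegral_const_mul _ (hh.pow_const p)]
    exact ENNReal.mul_lt_top (ENNReal.rpow_lt_top_of_nonneg hp0 ENNReal.ofNat_ne_top) hint
  have hbound := lintegral_rpow_le_of_mul_meas_lt_le (P.restrict (closedBall x₀ ρ))
    (P.restrict (closedBall x₀ (ρ + T))) (ψ := truncatedMaximal (P.withDensity h) P T)
    (hh.const_mul 2) hp (ENNReal.natCast_ne_top N) fun t _ => by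
      rw [Measure.restrict_apply' measurableSet_closedBall]
      exact hN P h hh x₀ ρ T _
  refine ENNReal.lt_top_of_mul_ne_top_right (hbound.trans_lt ?_).ne (by simpa using hp)
  exact ENNReal.mul_lt_top
    (ENNReal.mul_lt_top ENNReal.ofReal_lt_top (ENNReal.natCast_lt_top N)) hint'

end TruncatedMaximal

section ConvexGeometry

variable {E : Type*} [NormedAddCommGroup E] [NormedSpace ℝ E] [FiniteDimensional ℝ E]
  [MeasurableSpace E] [BorelSpace E]

-- The homothety with centre `x ∈ C` and ratio `ε` maps `C ∩ B(x, L)` into `C ∩ B(x, ε L)`.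
theorem ofReal_pow_mul_measure_inter_closedBall_le (lam : Measure E) [lam.IsAddHaarMeasure]
    {C : Set E} (hC : Convex ℝ C) {x : E} (hx : x ∈ C) {ε : ℝ} (hε : ε ∈ Icc (0 : ℝ) 1) (L : ℝ) :
    ENNReal.ofReal (ε ^ finrank ℝ E) * lam (C ∩ closedBall x L) ≤
      lam (C ∩ closedBall x (ε * L)) := by
  rw [← abs_of_nonneg (pow_nonneg hε.1 (finrank ℝ E)), ← Measure.addHaar_image_homothety lam x]
  refine measure_mono ?_
  rintro _ ⟨y, ⟨hyC, hyL⟩, rfl⟩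
  refine ⟨?_, ?_⟩
  · rw [AffineMap.homothety_eq_lineMap]
    exact hC.lineMap_mem hx hyC hε
  · rw [mem_closedBall, dist_homothety_center, Real.norm_of_nonneg hε.1]
    exact mul_le_mul_of_nonneg_left (mem_closedBall'.1 hyL) hε.1

theorem exists_measure_closedBall_le_mul_of_convex (lam : Measure E) [lam.IsAddHaarMeasure]
    {C : Set E} (hC : Convex ℝ C) (hpos : lam C ≠ 0) (M T : ℝ) :
    ∃ c : ℝ≥0∞, c ≠ ∞ ∧ ∀ x ∈ C ∩ closedBall 0 M, ∀ t ∈ Ioc 0 T,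
      lam (closedBall x t) ≤ c * lam (C ∩ closedBall x t) := by
  obtain ⟨n, hn⟩ : ∃ n : ℕ, lam (C ∩ closedBall 0 n) ≠ 0 := by
    by_contra! hnull
    refine hpos ?_
    rw [← inter_univ C, ← iUnion_closedBall_nat (0 : E), inter_iUnion]
    exact measure_iUnion_null hnull
  set D := C ∩ closedBall (0 : E) n
  have hD : lam D ≠ ∞ := measure_ne_top_of_subset inter_subset_right measure_closedBall_lt_top.ne
  set L : ℝ := M + n + T
  refine ⟨lam (closedBall 0 L) / lam D, ENNReal.div_ne_top measure_closedBall_lt_top.ne hn, ?_⟩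
  rintro x ⟨hxC, hxM⟩ t ⟨ht0, htT⟩
  have hM : dist x 0 ≤ M := hxM
  have hM0 : 0 ≤ M := dist_nonneg.trans hM
  have htL : t ≤ L := by have := n.cast_nonneg (α := ℝ); linarith
  have hL0 : 0 < L := ht0.trans_le htL
  have hDL : D ⊆ C ∩ closedBall x L :=
    inter_subset_inter_right C (closedBall_subset_closedBall' (by rw [dist_comm]; linarith))
  have ht : t / L * L = t := div_mul_cancel₀ t hL0.ne'
  have hε : t / L ∈ Icc (0 : ℝ) 1 := ⟨div_nonneg ht0.le hL0.le, (div_le_one hL0).2 htL⟩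
  calc lam (closedBall x t)
      = ENNReal.ofReal ((t / L) ^ finrank ℝ E) * lam (closedBall 0 L) := by
        rw [← Measure.addHaar_closedBall_mul lam x hε.1 hL0.le, ht]
    _ = lam (closedBall 0 L) / lam D * (ENNReal.ofReal ((t / L) ^ finrank ℝ E) * lam D) := by
        rw [mul_left_comm, ENNReal.div_mul_cancel hn hD]
    _ ≤ lam (closedBall 0 L) / lam D *
          (ENNReal.ofReal ((t / L) ^ finrank ℝ E) * lam (C ∩ closedBall x L)) := by gcongr
    _ ≤ lam (closedBall 0 L) / lam D * lam (C ∩ closedBall x t) := by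
        gcongr
        exact (ofReal_pow_mul_measure_inter_closedBall_le lam hC hxC hε L).trans_eq (by rw [ht])

theorem exists_ae_measure_closedBall_le_mul_of_sUnion_convex (lam : Measure E)
    [lam.IsAddHaarMeasure] {𝒞 : Set (Set E)} (hfin : 𝒞.Finite) (hconv : ∀ C ∈ 𝒞, Convex ℝ C)
    (M T : ℝ) :
    ∃ c : ℝ≥0∞, c ≠ ∞ ∧ ∀ᵐ x ∂lam, x ∈ ⋃₀ 𝒞 ∩ closedBall 0 M → ∀ t ∈ Ioc 0 T,
      lam (closedBall x t) ≤ c * lam (⋃₀ 𝒞 ∩ closedBall x t) := by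
  choose! c hc hle using fun C (hC : C ∈ {C ∈ 𝒞 | lam C ≠ 0}) =>
    exists_measure_closedBall_le_mul_of_convex lam (hconv C hC.1) hC.2 M T
  set F := (hfin.subset (sep_subset 𝒞 fun C => lam C ≠ 0)).toFinset
  have hnull : ∀ᵐ x ∂lam, ∀ C ∈ 𝒞, lam C = 0 → x ∉ C :=
    (ae_ball_iff hfin.countable).2 fun C _ =>
      Filter.eventually_imp_distrib_left.2 measure_eq_zero_iff_ae_notMem.1
  refine ⟨∑ C ∈ F, c C, ENNReal.sum_ne_top.2 fun C hC => hc C (by simpa [F] using hC), ?_⟩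
  filter_upwards [hnull] with x hx ⟨⟨C, hC, hxC⟩, hxM⟩ t ht
  have hCpos : C ∈ {C ∈ 𝒞 | lam C ≠ 0} := ⟨hC, fun h0 => hx C hC h0 hxC⟩
  refine (hle C hCpos x ⟨hxC, hxM⟩ t ht).trans ?_
  gcongr
  · exact Finset.single_le_sum (f := c) (fun _ _ => zero_le) (by simpa [F] using hCpos)
  · exact subset_sUnion_of_mem hC

end ConvexGeometry

theorem le_withDensity_inv_of_le_of_absolutelyContinuous {X : Type*} [MeasurableSpace X]
    {lam ν : Measure X} {f : X → ℝ≥0∞} (hf : Measurable f) (hf_top : ∀ᵐ x ∂lam, f x ≠ ∞)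
    (hle : ν ≤ lam) (hac : ν ≪ lam.withDensity f) :
    ν ≤ (lam.withDensity f).withDensity f⁻¹ := by
  have hf_zero : ∀ᵐ x ∂ν, f x ≠ 0 :=
    hac.ae_le ((ae_withDensity_iff hf).2 (Filter.Eventually.of_forall fun _ => id))
  have hmono : ν.withDensity f ≤ lam.withDensity f := Measure.le_iff.2 fun s hs => by
    simp only [withDensity_apply f hs]
    exact lintegral_mono' (Measure.restrict_mono le_rfl hle) le_rfl
  calc ν = (ν.withDensity f).withDensity f⁻¹ :=
        (withDensity_inv_same hf hf_zero (ae_mono hle hf_top)).symm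
    _ ≤ (lam.withDensity f).withDensity f⁻¹ := Measure.le_iff.2 fun s hs => by
        simp only [withDensity_apply _ hs]
        exact lintegral_mono' (Measure.restrict_mono le_rfl hmono) le_rfl

section Dilation

variable {E : Type*} [NormedAddCommGroup E] [NormedSpace ℝ E] [FiniteDimensional ℝ E]
  [MeasurableSpace E] [BorelSpace E] (lam : Measure E) [lam.IsAddHaarMeasure] {θ : ℝ}

theorem scaledLaw_addHaar (hθ : θ ≠ 0) (μ : E) :
    scaledLaw lam θ μ = ENNReal.ofReal |θ ^ finrank ℝ E| • lam := by
  have hcomp : (fun x : E => θ⁻¹ • (x - μ) + μ) = (· + μ) ∘ (θ⁻¹ • ·) ∘ (· - μ) := rfl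
  rw [scaledLaw, hcomp, ← Measure.map_map (by fun_prop) (by fun_prop),
    ← Measure.map_map (by fun_prop) (by fun_prop), (measurePreserving_sub_right lam μ).map_eq,
    Measure.map_addHaar_smul lam (inv_ne_zero hθ), Measure.map_smul,
    (measurePreserving_add_right lam μ).map_eq, inv_pow, inv_inv]

theorem scaledLaw_withDensity (hθ : θ ≠ 0) (μ : E) {g : E → ℝ≥0∞} (hg : Measurable g) :
    scaledLaw (lam.withDensity g) θ μ =
      ENNReal.ofReal |θ ^ finrank ℝ E| • lam.withDensity fun z => g (μ + θ • (z - μ)) := by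
  rw [← withDensity_smul_measure, ← scaledLaw_addHaar lam hθ μ]
  ext B hB
  rw [withDensity_apply _ hB, scaledLaw, scaledLaw, Measure.map_apply (by fun_prop) hB,
    withDensity_apply _ (by measurability), setLIntegral_map hB (by fun_prop) (by fun_prop)]
  simp [smul_smul, hθ]

variable {lam} {μ : E} {f : E → ℝ≥0}

theorem Admissible.ae_pos (hadm : Admissible lam f θ μ) (hθ : θ ≠ 0) :
    ∀ᵐ z ∂lam, 0 < f (μ + θ • (z - μ)) → 0 < f z := by
  have hlaw : ∀ᵐ x ∂scaledLaw lam θ⁻¹ μ,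
      0 < f x → x ∈ (fun y => (1 - θ) • μ + θ • y) '' {y | 0 < f y} := by
    rw [scaledLaw_addHaar lam (inv_ne_zero hθ)]
    exact Measure.ae_smul_measure hadm _
  filter_upwards [ae_of_ae_map (by fun_prop) hlaw] with z hz hfz
  rw [inv_inv, add_comm] at hz
  obtain ⟨y, hy, hyz : (1 - θ) • μ + θ • y = μ + θ • (z - μ)⟩ := hz hfz
  have hyz' : θ • y = θ • z := by linear_combination (norm := module) hyz
  rwa [smul_right_injective E hθ hyz'] at hy

theorem exists_restrict_scaledLaw_le_smul (hf : Measurable f) (hθ : θ ≠ 0)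
    (hadm : Admissible lam f θ μ) (h1 : H1 f θ μ) {M : ℝ} (hM : 0 < M) :
    ∃ C : ℝ≥0∞, C ≠ ∞ ∧
      (scaledLaw (lam.withDensity fun x => f x) θ μ).restrict (closedBall 0 M) ≤
        C • (lam.withDensity fun x => (f x : ℝ≥0∞)).restrict (closedBall 0 M) := by
  obtain ⟨c, hc⟩ := h1 M hM
  have hratio : ∀ᵐ z ∂lam.restrict (closedBall 0 M), (f (μ + θ • (z - μ)) : ℝ≥0∞) ≤ c * f z := by
    filter_upwards [ae_restrict_of_ae (hadm.ae_pos hθ), ae_restrict_mem measurableSet_closedBall]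
      with z hpos hzM
    rcases eq_zero_or_pos (f (μ + θ • (z - μ))) with h0 | h0
    · simp [h0]
    · have hfz : 0 < f z := hpos h0
      have hcz := hc ⟨z, hzM, indicator_of_mem (show z ∈ {z | 0 < f z} from hfz) _⟩
      exact_mod_cast (div_le_iff₀ hfz).1 hcz
  refine ⟨ENNReal.ofReal |θ ^ finrank ℝ E| * c,
    ENNReal.mul_ne_top ENNReal.ofReal_ne_top ENNReal.coe_ne_top, ?_⟩
  rw [scaledLaw_withDensity lam hθ μ hf.coe_nnreal_ennreal, Measure.restrict_smul,
    restrict_withDensity measurableSet_closedBall, restrict_withDensity measurableSet_closedBall,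
    mul_smul, ← withDensity_smul _ hf.coe_nnreal_ennreal]
  gcongr
  exact withDensity_mono hratio

end Dilation

section Grids

variable {E : Type*} [NormedAddCommGroup E] [MeasurableSpace E]

theorem exists_mem_norm_le_of_distortion_le [BorelSpace E] {P : Measure E}
    [IsProbabilityMeasure P] {r : ℝ} (hr : 0 < r) (hfin : distortion P r {0} ≠ ∞) {α : Finset E}
    (hne : α.Nonempty) (hα : distortion P r α ≤ distortion P r {0}) :
    ∃ a ∈ α, ‖a‖ ≤ 2 * (2 * (distortion P r {0}).toReal) ^ r⁻¹ := by
  set I := distortion P r {0} with hI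
  have hmeas : Measurable fun x : E => ENNReal.ofReal (‖x‖ ^ r) := by fun_prop
  -- Some point is close both to the origin and to `α`, by adding the two `r`-th moments.
  obtain ⟨x, hx⟩ := exists_le_lintegral (μ := P)
    (f := fun x => ENNReal.ofReal (‖x‖ ^ r) + ENNReal.ofReal (infDist x (α : Set E) ^ r))
    (hmeas.add (by measurability)).aemeasurable
  have hsum : ‖x‖ ^ r + infDist x (α : Set E) ^ r ≤ 2 * I.toReal := by
    refine (ENNReal.ofReal_le_iff_le_toReal (b := 2 * I) (by finiteness)).1 ?_ |>.trans_eq (by simp)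
    calc ENNReal.ofReal (‖x‖ ^ r + infDist x (α : Set E) ^ r)
        = ENNReal.ofReal (‖x‖ ^ r) + ENNReal.ofReal (infDist x (α : Set E) ^ r) :=
          ENNReal.ofReal_add (by positivity) (Real.rpow_nonneg infDist_nonneg r)
      _ ≤ I + distortion P r α := by
          refine hx.trans_eq ?_
          rw [lintegral_add_left hmeas]
          simp [hI, distortion]
      _ ≤ 2 * I := by rw [two_mul]; gcongr
  have hR : 0 ≤ 2 * I.toReal := by positivity
  have hnorm : ‖x‖ ≤ (2 * I.toReal) ^ r⁻¹ :=
    (Real.le_rpow_inv_iff_of_pos (norm_nonneg x) hR hr).2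
      (by linarith [Real.rpow_nonneg (infDist_nonneg (x := x) (s := (α : Set E))) r])
  have hdist : infDist x (α : Set E) ≤ (2 * I.toReal) ^ r⁻¹ :=
    (Real.le_rpow_inv_iff_of_pos infDist_nonneg hR hr).2
      (by linarith [Real.rpow_nonneg (norm_nonneg x) r])
  obtain ⟨a, ha, hxa⟩ := α.finite_toSet.isCompact.exists_infDist_eq_dist hne x
  refine ⟨a, ha, ?_⟩
  linarith [norm_le_norm_add_norm_sub' a x, dist_eq_norm x a, norm_sub_rev x a]

theorem IsOptimalSeq.exists_norm_le [BorelSpace E] {P : Measure E} [IsProbabilityMeasure P]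
    {r : ℝ} (hr : 0 < r) (hfin : distortion P r {0} ≠ ∞) {α : ℕ → Finset E}
    (hα : IsOptimalSeq P r α) : ∃ K : ℝ, ∀ n, 1 ≤ n → ∃ a ∈ α n, ‖a‖ ≤ K := by
  refine ⟨2 * (2 * (distortion P r {0}).toReal) ^ r⁻¹, fun n hn => ?_⟩
  obtain ⟨hne, -, hopt⟩ := hα n hn
  refine exists_mem_norm_le_of_distortion_le hr hfin hne (hopt.trans_le ?_)
  exact iInf₂_le_of_le {0} (Finset.singleton_nonempty 0) (iInf_le _ (by simpa using hn))

theorem distortion_singleton_zero_ne_top {P : Measure E} [IsFiniteMeasure P] {r q : ℝ}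
    (hr : 0 ≤ r) (hrq : r ≤ q) (hmoment : Integrable (fun x => ‖x‖ ^ q) P) :
    distortion P r {0} ≠ ∞ := by
  have hle (x : E) : ‖x‖ ^ r ≤ 1 + ‖x‖ ^ q := by
    rcases le_total ‖x‖ 1 with hx | hx
    · linarith [Real.rpow_le_one (norm_nonneg x) hx hr, Real.rpow_nonneg (norm_nonneg x) q]
    · linarith [Real.rpow_le_rpow_of_exponent_le hx hrq]
  have hint : Integrable (fun x : E => 1 + ‖x‖ ^ q) P := (integrable_const 1).add hmoment
  refine (lt_of_le_of_lt (lintegral_mono fun x => ENNReal.ofReal_le_ofReal ?_)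
    hint.lintegral_lt_top).ne
  simpa using hle x

end Grids

section MaximalFunction

variable {E : Type*} [NormedAddCommGroup E] [MeasurableSpace E]

theorem measurable_measure_closedBall [SecondCountableTopology E] [BorelSpace E] (ν : Measure E)
    [SFinite ν] {ρ : E → ℝ} (hρ : Continuous ρ) : Measurable fun x => ν (closedBall x (ρ x)) := by
  have hclosed : IsClosed {z : E × E | dist z.2 z.1 ≤ ρ z.1} :=
    isClosed_le (continuous_snd.dist continuous_fst) (hρ.comp continuous_fst)
  exact measurable_measure_prodMk_left hclosed.measurableSet

theorem measurable_maximalFunction [SecondCountableTopology E] [BorelSpace E] (lam P : Measure E)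
    [SFinite lam] [SFinite P] (α : ℕ → Finset E) (b : ℝ) :
    Measurable (maximalFunction lam P α b) :=
  Measurable.iSup fun n => Measurable.iSup fun _ =>
    have hradius : Continuous fun x : E => b * infDist x (α n : Set E) := by fun_prop
    (measurable_measure_closedBall lam hradius).div (measurable_measure_closedBall P hradius)

theorem maximalFunction_le_truncatedMaximal (lam P : Measure E) [NullSingletonClass lam]
    {α : ℕ → Finset E} {b T : ℝ} (hb : 0 ≤ b) {x : E}
    (hT : ∀ n, 1 ≤ n → b * infDist x (α n : Set E) ≤ T) :
    maximalFunction lam P α b x ≤ truncatedMaximal lam P T x := by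
  refine iSup₂_le fun n hn => ?_
  rcases (mul_nonneg hb (infDist_nonneg (x := x) (s := (α n : Set E)))).eq_or_lt with h0 | hpos
  · simp [← h0, ballRatio]
  · exact ballRatio_le_truncatedMaximal lam P x ⟨hpos, hT n hn⟩

theorem div_mul_infDist_le_max {E : Type*} [SeminormedAddCommGroup E] {A : Set E} {K M : ℝ}
    (hM : 0 < M) (hA : ∃ a ∈ A, ‖a‖ ≤ K) (x : E) : M / (K + M) * infDist x A ≤ max M ‖x‖ := by
  obtain ⟨a, ha, haK⟩ := hA
  have hK : 0 ≤ K := (norm_nonneg a).trans haK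
  have hdist : infDist x A ≤ K + ‖x‖ :=
    (infDist_le_dist_of_mem ha).trans (by linarith [dist_le_norm_add_norm x a])
  rw [div_mul_eq_mul_div, div_le_iff₀ (by positivity)]
  calc M * infDist x A ≤ M * K + M * ‖x‖ := by nlinarith
    _ ≤ max M ‖x‖ * K + max M ‖x‖ * M := by
        rw [mul_comm M ‖x‖]
        gcongr
        exacts [le_max_left M ‖x‖, le_max_right M ‖x‖]
    _ = max M ‖x‖ * (K + M) := (mul_add _ _ _).symm

theorem maximalIntegrability_of_setLIntegral_truncatedMaximal [NormedSpace ℝ E]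
    [SecondCountableTopology E] [BorelSpace E] {lam P : Measure E} [SFinite lam]
    [NullSingletonClass lam] [SFinite P] {r s θ : ℝ} {μ : E} (hp : 0 ≤ s / (finrank ℝ E + r))
    (h2 : H2 lam P r s θ μ)
    (hdom : ∀ M : ℝ, 0 < M → ∃ C : ℝ≥0∞, C ≠ ∞ ∧
      (scaledLaw P θ μ).restrict (closedBall 0 M) ≤ C • P.restrict (closedBall 0 M))
    {α : ℕ → Finset E} (hα : ∃ K : ℝ, ∀ n, 1 ≤ n → ∃ a ∈ α n, ‖a‖ ≤ K)
    (hloc : ∀ M T : ℝ, ∫⁻ x in closedBall 0 M,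
      truncatedMaximal lam P T x ^ (s / (finrank ℝ E + r)) ∂P < ∞) :
    MaximalIntegrability lam P r s θ μ α := by
  obtain ⟨b₀, ⟨hb₀, hb₀_half⟩, M, hM, hfar⟩ := h2
  obtain ⟨K, hK⟩ := hα
  have hK0 : 0 ≤ K := let ⟨a, _, ha⟩ := hK 1 le_rfl; (norm_nonneg a).trans ha
  set b := b₀ * (M / (K + M)) with hb
  have hb0 : 0 < b := by positivity
  have hbb₀ : b ≤ b₀ := mul_le_of_le_one_right hb₀.le ((div_le_one (by positivity)).2 (by linarith))
  have hradius (x : E) (n : ℕ) (hn : 1 ≤ n) :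
      b * infDist x (α n : Set E) ≤ b₀ * max M ‖x‖ := by
    rw [hb, mul_assoc]
    exact mul_le_mul_of_nonneg_left (div_mul_infDist_le_max hM (hK n hn) x) hb₀.le
  have hψ := (measurable_maximalFunction lam P α b).pow_const (s / (finrank ℝ E + r))
  refine ⟨b, ⟨hb0, hbb₀.trans_lt hb₀_half⟩, hψ.aestronglyMeasurable, ?_⟩
  rw [hasFiniteIntegral_iff_enorm]
  simp only [enorm_eq_self]
  rw [← lintegral_add_compl _ (measurableSet_closedBall (x := (0 : E)) (ε := M))]
  refine ENNReal.add_lt_top.2 ⟨?_, ?_⟩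
  · obtain ⟨C, hC, hle⟩ := hdom M hM
    calc ∫⁻ x in closedBall 0 M, maximalFunction lam P α b x ^ (s / (finrank ℝ E + r))
          ∂(scaledLaw P θ μ)
        ≤ C * ∫⁻ x in closedBall 0 M, maximalFunction lam P α b x ^ (s / (finrank ℝ E + r)) ∂P :=
          (lintegral_mono' hle le_rfl).trans_eq (lintegral_smul_measure _ _)
      _ ≤ C * ∫⁻ x in closedBall 0 M,
            truncatedMaximal lam P (b₀ * M) x ^ (s / (finrank ℝ E + r)) ∂P := by
          gcongr C * ?_
          refine setLIntegral_mono' measurableSet_closedBall fun x hx => ?_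
          rw [mem_closedBall_zero_iff] at hx
          refine ENNReal.rpow_le_rpow (maximalFunction_le_truncatedMaximal lam P hb0.le ?_) hp
          simpa [hx] using hradius x
      _ < ∞ := ENNReal.mul_lt_top hC.lt_top (hloc M (b₀ * M))
  · refine (setLIntegral_mono' measurableSet_closedBall.compl fun x hx => ?_).trans_lt hfar
    have hMx : M < ‖x‖ := by simpa using hx
    refine ENNReal.rpow_le_rpow
      (maximalFunction_le_truncatedMaximal lam P hb0.le fun n hn => ?_) hp
    calc b * infDist x (α n : Set E) ≤ b₀ * ‖x‖ := by simpa [hMx.le] using hradius x n hn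
      _ ≤ 2 * b₀ * ‖x‖ := by nlinarith [norm_nonneg x]

end MaximalFunction

section ConvexSupport

variable {E : Type*} [NormedAddCommGroup E] [NormedSpace ℝ E] [FiniteDimensional ℝ E]
  [MeasurableSpace E] [BorelSpace E] {lam : Measure E} [lam.IsAddHaarMeasure] {f : E → ℝ≥0∞}

theorem H3.exists_ae_measure_closedBall_le_withDensity (h3 : H3 lam (lam.withDensity f))
    (hf : Measurable f) (hf_top : ∀ᵐ x ∂lam, f x ≠ ∞) (M T : ℝ) :
    ∃ c : ℝ≥0∞, c ≠ ∞ ∧ ∀ᵐ x ∂(lam.withDensity f), x ∈ closedBall 0 M → ∀ t ∈ Ioc 0 T,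
      lam (closedBall x t) ≤ (lam.withDensity f).withDensity (c • f⁻¹) (closedBall x t) := by
  set P := lam.withDensity f
  obtain ⟨hac, 𝒞, hfin, hconv, hsupp⟩ := h3
  obtain ⟨c, hc, hball⟩ :=
    exists_ae_measure_closedBall_le_mul_of_sUnion_convex lam hfin (fun C hC => (hconv C hC).2) M T
  rw [← hsupp] at hball
  have hinv : lam.restrict P.support ≤ P.withDensity f⁻¹ :=
    le_withDensity_inv_of_le_of_absolutelyContinuous hf hf_top Measure.restrict_le_self hac
  refine ⟨c, hc, ?_⟩
  filter_upwards [(withDensity_absolutelyContinuous lam f).ae_le hball,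
    Measure.support_mem_ae] with x hx hxP hxM t ht
  calc lam (closedBall x t) ≤ c * lam (P.support ∩ closedBall x t) := hx ⟨hxP, hxM⟩ t ht
    _ = c * lam.restrict P.support (closedBall x t) := by
        rw [Measure.restrict_apply measurableSet_closedBall, inter_comm]
    _ ≤ c * P.withDensity f⁻¹ (closedBall x t) := by gcongr
    _ = P.withDensity (c • f⁻¹) (closedBall x t) := by
        rw [withDensity_smul c hf.inv, Measure.smul_apply, smul_eq_mul]

theorem H3.setLIntegral_truncatedMaximal_rpow_lt_top (h3 : H3 lam (lam.withDensity f))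
    (hf : Measurable f) (hf_top : ∀ᵐ x ∂lam, f x ≠ ∞) {p : ℝ} (hp : 1 < p) {M T : ℝ}
    (hint : ∫⁻ x in closedBall 0 (M + T), f x ^ (-p) ∂(lam.withDensity f) < ∞) :
    ∫⁻ x in closedBall 0 M, truncatedMaximal lam (lam.withDensity f) T x ^ p
      ∂(lam.withDensity f) < ∞ := by
  set P := lam.withDensity f
  obtain ⟨c, hc, hball⟩ := h3.exists_ae_measure_closedBall_le_withDensity hf hf_top M T
  have hp0 : 0 ≤ p := by linarith
  have hcp : c ^ p ≠ ∞ := ENNReal.rpow_ne_top_of_nonneg hp0 hc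
  calc ∫⁻ x in closedBall 0 M, truncatedMaximal lam P T x ^ p ∂P
      ≤ ∫⁻ x in closedBall 0 M, truncatedMaximal (P.withDensity (c • f⁻¹)) P T x ^ p ∂P := by
        refine lintegral_mono_ae ((ae_restrict_iff' measurableSet_closedBall).2 ?_)
        filter_upwards [hball] with x hx hxM
        exact ENNReal.rpow_le_rpow (truncatedMaximal_mono (hx hxM)) hp0
    _ < ∞ := by
        refine setLIntegral_truncatedMaximal_withDensity_rpow_lt_top P (hf.inv.const_smul c) hp ?_
        simp only [Pi.smul_apply, Pi.inv_apply, smul_eq_mul, ENNReal.mul_rpow_of_nonneg _ _ hp0,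
          ENNReal.inv_rpow, ← ENNReal.rpow_neg]
        rw [lintegral_const_mul' _ _ hcp]
        exact ENNReal.mul_lt_top hcp.lt_top hint

end ConvexSupport

end Quantization

end

theorem corollary3p1_general
    {E : Type*} [NormedAddCommGroup E] [NormedSpace ℝ E] [FiniteDimensional ℝ E] [Nontrivial E]
    [MeasurableSpace E] [BorelSpace E]
    (lam : Measure E) [lam.IsAddHaarMeasure]
    (P : Measure E) [IsLocallyFiniteMeasure P]
    (f : E → ℝ≥0) (hf : Measurable f) (hP : P = lam.withDensity (fun x => (f x : ℝ≥0∞)))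
    (r s θ : ℝ) (μ : E) (hr : 0 < r + finrank ℝ E) (hs : 0 < s) (hθ : θ ≠ 0)
    (hadm : Quantization.Admissible lam f θ μ)
    (h1 : Quantization.H1 f θ μ) (h2 : Quantization.H2 lam P r s θ μ)
    (α : ℕ → Finset E) (hα : ∃ K : ℝ, ∀ n, 1 ≤ n → ∃ a ∈ α n, ‖a‖ ≤ K) :
    (s < r + finrank ℝ E → Quantization.MaximalIntegrability lam P r s θ μ α) ∧
    (r + finrank ℝ E < s → Quantization.H3 lam P →
      LocallyIntegrable (fun x => (f x : ℝ≥0∞) ^ (-(s / (r + finrank ℝ E)))) P →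
      Quantization.MaximalIntegrability lam P r s θ μ α) := by
  subst hP
  have hlocal := Quantization.maximalIntegrability_of_setLIntegral_truncatedMaximal
    (by rw [add_comm]; positivity) h2
    (fun M hM => Quantization.exists_restrict_scaledLaw_le_smul hf hθ hadm h1 hM) hα
  rw [add_comm (finrank ℝ E : ℝ)] at hlocal
  refine ⟨fun hlt => hlocal fun M T => ?_, fun hlt h3 hint => hlocal fun M T => ?_⟩
  · exact Quantization.setLIntegral_truncatedMaximal_rpow_lt_top_of_lt_one _ _
      (div_pos hs hr) ((div_lt_one hr).2 hlt) 0 M T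
  · refine h3.setLIntegral_truncatedMaximal_rpow_lt_top hf.coe_nnreal_ennreal
      (Filter.Eventually.of_forall fun _ => ENNReal.coe_ne_top) ((one_lt_div hr).2 hlt) ?_
    simpa only [hasFiniteIntegral_iff_enorm, enorm_eq_self] using
      (hint.integrableOn_isCompact (isCompact_closedBall 0 (M + T))).hasFiniteIntegral

theorem corollary3p1
    {E : Type*} [NormedAddCommGroup E] [NormedSpace ℝ E] [FiniteDimensional ℝ E] [Nontrivial E]
    [MeasurableSpace E] [BorelSpace E]
    (lam : Measure E) [lam.IsAddHaarMeasure]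
    (P : Measure E) [IsProbabilityMeasure P]
    (f : E → ℝ≥0) (hf : Measurable f) (hP : P = lam.withDensity (fun x => (f x : ℝ≥0∞)))
    (r s η θ : ℝ) (μ : E) (hr : 0 < r) (hs : 0 < s) (hη : 0 < η) (hθ : 0 < θ)
    (hmoment : Integrable (fun x => ‖x‖ ^ (r + η)) P)
    (hadm : Quantization.Admissible lam f θ μ)
    (h1 : Quantization.H1 f θ μ) (h2 : Quantization.H2 lam P r s θ μ)
    (α : ℕ → Finset E) (hα : Quantization.IsOptimalSeq P r α) :
    (s < r + finrank ℝ E → Quantization.MaximalIntegrability lam P r s θ μ α) ∧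
    (r + finrank ℝ E < s → Quantization.H3 lam P →
      LocallyIntegrable (fun x => (f x : ℝ≥0∞) ^ (-(s / (r + finrank ℝ E)))) P →
      Quantization.MaximalIntegrability lam P r s θ μ α) :=
  corollary3p1_general lam P f hf hP r s θ μ (by positivity) hs hθ.ne' hadm h1 h2 α <|
    hα.exists_norm_le hr <|
      Quantization.distortion_singleton_zero_ne_top hr.le (le_add_of_nonneg_right hη.le) hmoment
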